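/- Let $0<\delta<1$, let $D_1=\{|z|<\delta\}$ and $D_2=\{|z|>1/\delta\}\cup\{\infty\}$ be discs around $0$ and $\infty$ in the Riemann sphere, and let $\phi_1,\phi_2$ be holomorphic functions on $D_1\cup D_2$ that are odd: $\phi_i(-z)=-\phi_i(z)$ (in particular $\phi_i(0)=\phi_i(\infty)=0$). Fix $0<\rho_1<\delta$ and $\rho_2>1/\delta$. For $|r|<\rho_1^2$ and $|s|>\rho_2^2$ cut the plane along the segment from $-\sqrt r$ to $\sqrt r$ and along the two rays that join $\sqrt s$ and $-\sqrt s$ through $\infty$. Let $W\subset\{(r,s)\in\mathbb C^2:|r|<\rho_1^2,\ |s|>\rho_2^2\}$ be a non-empty open set over which a branch of $(z^2-r)^{1/2}(z^2-s)^{1/2}$ has been chosen that is continuous in $(r,s)\in W$ and in $z$ in the cut plane (such a branch always exists over small $W$, where it is unique up to sign). For $(r,s)\in W$ put $$ G_i(r,s)=-\frac1{4\pi i}\int_C\frac{z\,\phi_i(z)}{(z^2-r)^{1/2}(z^2-s)^{1/2}}\,dz ,\qquad i=1,2, $$ where $C$ consists of the circle $|z|=\rho_1$, run through counterclockwise, and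 the circle $|z|=\rho_2$, run through clockwise (so each component is positively oriented about the cut that it surrounds, at $0$ and at $\infty$ respectively). Let $a,b,c,d\in\mathbb C$ and suppose that for all $(r,s)\in W$ $$ (ar+b)\frac{\partial G_1}{\partial r}+(cr+d)\frac{\partial G_2}{\partial r}+(as+b)\frac{\partial G_1}{\partial s}+(cs+d)\frac{\partial G_2}{\partial s}=0 . $$ Then $(az^2+b)\phi_1'(z)+(cz^2+d)\phi_2'(z)$ is constant: there is a single $k\in\mathbb C$ such that it equals $k$ for every $z\in\mathbb C$ with $|z|<\delta$ or $|z|>1/\delta$. -/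

import Mathlib

open Real Set Filter Topology

noncomputable section

/-- The disc `|z| < δ` around `0`. -/
def discZero (δ : ℝ) : Set ℂ := {z | ‖z‖ < δ}

/-- The disc `|z| > 1/δ` around `∞` (without the point `∞`). -/
def discInfty (δ : ℝ) : Set ℂ := {z | δ⁻¹ < ‖z‖}

/-- `φ` is an odd holomorphic function on the discs of radius `δ` around `0` and around `∞` in the
Riemann sphere.  Oddness forces the value `0` at `∞`, so holomorphy at `∞` is (by the theorem on
removable singularities) the statement that `φ` is holomorphic on the punctured disc and tends to
`0` at `∞`. -/
structure IsOddHolomorphic (δ : ℝ) (φ : ℂ → ℂ) : Prop where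
  differentiableOn_zero : DifferentiableOn ℂ φ (discZero δ)
  differentiableOn_infty : DifferentiableOn ℂ φ (discInfty δ)
  tendsto_infty : Tendsto φ (Bornology.cobounded ℂ) (𝓝 0)
  odd : ∀ z ∈ discZero δ ∪ discInfty δ, φ (-z) = -φ z

/-- The plane cut along the segment from `-√r` to `√r` (through `0`), and along the two
rays that join `√s` and `-√s` through `∞`. -/
def cutPlane (r s : ℂ) : Set ℂ :=
  {z | (∀ t : ℝ, 0 ≤ t → t ≤ 1 → z ^ 2 ≠ t * r) ∧ (∀ t : ℝ, 1 ≤ t → z ^ 2 ≠ t * s)}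

/-- `R r s z` is a continuous branch of `(z² - r)^{1/2} (z² - s)^{1/2}`, for `(r, s)` in `W` and
`z` in the cut plane. -/
structure IsRootBranch (W : Set (ℂ × ℂ)) (R : ℂ → ℂ → ℂ → ℂ) : Prop where
  sq_eq : ∀ r s, (r, s) ∈ W → ∀ z ∈ cutPlane r s, R r s z ^ 2 = (z ^ 2 - r) * (z ^ 2 - s)
  continuousOn : ContinuousOn (fun q : (ℂ × ℂ) × ℂ => R q.1.1 q.1.2 q.2)
    {q | q.1 ∈ W ∧ q.2 ∈ cutPlane q.1.1 q.1.2}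

/-- The function
`G(r, s) = - (1 / 4πi) ∫_C z φ(z) / ((z² - r)^{1/2} (z² - s)^{1/2}) dz`,
where `R` is the branch of the root and `C` has two components, the circles `|z| = ρ₁` and
`|z| = ρ₂`.  Each is positively oriented about the cut that it surrounds, so that the second, which
goes around the cut through `∞`, is run through clockwise in the plane. -/
def twistorG (ρ₁ ρ₂ : ℝ) (R : ℂ → ℂ → ℂ → ℂ) (φ : ℂ → ℂ) (r s : ℂ) : ℂ :=
  -(1 / (4 * (π : ℂ) * Complex.I)) *
    ((∮ z in C(0, ρ₁), z * φ z / R r s z) - ∮ z in C(0, ρ₂), z * φ z / R r s z)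

end

/-!
Let `F(z) = (a z² + b) φ₁'(z) + (c z² + d) φ₂'(z)`; it is even and holomorphic near `0`
and near `∞`.

Since `1/R` has the logarithmic derivatives `1/(2(z² - r))`, `1/(2(z² - s))` and
`-z/(z² - r) - z/(z² - s)` in `r`, `s` and `z`, an integration by parts over each circle shows that
`(a r + b) ∂/∂r + (a s + b) ∂/∂s` turns the numerator `z φ(z)` into `(a z² + b) φ'(z) / 2`
(`IsRootBranch.circleIntegral_by_parts`, `twistorG_deriv_add_deriv`).  So the differential equation
says that the integrals of `F/R` over the circles `|z| = ρ₁` and `|z| = ρ₂` agree for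
`(r, s) ∈ W`.

In the annulus `ρ₁ ≤ |z| ≤ ρ₂` a connectedness argument gives
`1/R = (κ z)⁻¹ (1 - r/z²)^{-1/2} (1 - z²/s)^{-1/2}` with `κ² = -s` independent of `z`
(`IsRootBranch.exists_mul_rsqrtOneSub_eq`).  With `t = 1/s`, the equality of the integrals becomes
the equality of the averages of `F(z) (1 - r/z²)^{-1/2} (1 - t z²)^{-1/2}` over the two circles.
Both averages are holomorphic for `|r| < ρ₁²`, `|t| < ρ₂⁻²`, so by the identity theorem, used in one
variable at a time, they agree on this whole bidisc
(`IsRootBranch.circleAverage_eq_circleAverage`).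

For `t = 0`, the average over the outer circle is the value of `F` at `∞` by the mean value property
in the coordinate `1/z`, whatever `r` is.  The average over the inner circle is the power series
`∑ cₙ fₙ rⁿ`, where the `fₙ` are the even Taylor coefficients of `F` at `0` and the binomial
coefficients `cₙ` of `(1 - w)^{-1/2}` do not vanish.  Hence `fₙ = 0` for `n ≥ 1`, and `F` is equal
to its value at `∞` on the disc around `0` (`eqOn_const_of_circleAverage_mul_rsqrtOneSub`).  For
`r = 0` the roles of `0` and `∞` are exchanged (`exists_eq_const_of_circleAverage_eq`).
-/

/-! ### Derivatives under a circle integral and of continuous square roots -/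

/-- Differentiation under a circle integral: continuity of the derivative of the integrand on a
neighbourhood times the circle provides the bound that dominated convergence asks for. -/
theorem hasDerivAt_circleIntegral_of_continuousOn {U : Set ℂ} {K K' : ℂ → ℂ → ℂ} {x₀ : ℂ} {ρ : ℝ}
    (hρ : 0 ≤ ρ) (hU : U ∈ 𝓝 x₀) (hK : ∀ x ∈ U, ContinuousOn (K x) (Metric.sphere 0 ρ))
    (hK' : ContinuousOn (fun q : ℂ × ℂ => K' q.1 q.2) (U ×ˢ Metric.sphere 0 ρ))
    (h : ∀ x ∈ U, ∀ z ∈ Metric.sphere (0 : ℂ) ρ, HasDerivAt (fun x => K x z) (K' x z) x) :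
    HasDerivAt (fun x => ∮ z in C(0, ρ), K x z) (∮ z in C(0, ρ), K' x₀ z) x₀ := by
  obtain ⟨ε, hε, hεU⟩ := Metric.nhds_basis_closedBall.mem_iff.1 hU
  obtain ⟨B, hB⟩ := ((isCompact_closedBall x₀ ε).prod
    (isCompact_sphere (0 : ℂ) ρ)).exists_bound_of_continuousOn (hK'.mono (prod_mono_left hεU))
  have hc : ∀ f : ℂ → ℂ, ContinuousOn f (Metric.sphere 0 ρ) →
      Continuous fun θ : ℝ => deriv (circleMap 0 ρ) θ • f (circleMap 0 ρ θ) := by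
    intro f hf
    have h1 : Continuous fun θ : ℝ => f (circleMap 0 ρ θ) :=
      hf.comp_continuous (continuous_circleMap 0 ρ) fun θ => circleMap_mem_sphere 0 hρ θ
    simp only [deriv_circleMap]
    exact ((continuous_circleMap 0 ρ).mul continuous_const).smul h1
  have hx₀ : x₀ ∈ U := mem_of_mem_nhds hU
  have hK'c : ContinuousOn (K' x₀) (Metric.sphere 0 ρ) :=
    hK'.comp (f := fun z => (x₀, z)) (by fun_prop) fun z hz => ⟨hx₀, hz⟩
  refine (intervalIntegral.hasDerivAt_integral_of_dominated_loc_of_deriv_le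
    (F := fun x θ => deriv (circleMap 0 ρ) θ • K x (circleMap 0 ρ θ))
    (F' := fun x θ => deriv (circleMap 0 ρ) θ • K' x (circleMap 0 ρ θ))
    (bound := fun _ => ρ * B) (Metric.closedBall_mem_nhds x₀ hε) ?_ ?_ ?_ ?_ ?_ ?_).2
  · filter_upwards [hU] with x hx
    exact (hc _ (hK x hx)).aestronglyMeasurable
  · exact (hc _ (hK _ hx₀)).intervalIntegrable _ _
  · exact (hc _ hK'c).aestronglyMeasurable
  · refine Eventually.of_forall fun θ _ x hx => ?_
    rw [norm_smul]
    have h1 := hB (x, circleMap 0 ρ θ) ⟨hx, circleMap_mem_sphere 0 hρ θ⟩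
    have h2 : ‖deriv (circleMap 0 ρ) θ‖ = ρ := by simp [deriv_circleMap, abs_of_nonneg hρ]
    rw [h2]
    exact mul_le_mul_of_nonneg_left h1 hρ
  · exact intervalIntegrable_const
  · refine Eventually.of_forall fun θ _ x hx => ?_
    simpa only [smul_eq_mul] using (h x (hεU hx) _ (circleMap_mem_sphere 0 hρ θ)).const_mul _

theorem hasDerivAt_of_sq_eq {k g : ℂ → ℂ} {x g' : ℂ} (hk : ContinuousAt k x)
    (hg : HasDerivAt g g' x) (h : ∀ᶠ y in 𝓝 x, k y ^ 2 = g y) (h0 : k x ≠ 0) :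
    HasDerivAt k (g' / (2 * k x)) x := by
  rw [hasDerivAt_iff_tendsto_slope] at hg ⊢
  have hsum : Tendsto (fun y => k y + k x) (𝓝 x) (𝓝 (2 * k x)) := by
    rw [two_mul]
    exact hk.tendsto.add_const _
  have h2 : 2 * k x ≠ 0 := mul_ne_zero two_ne_zero h0
  refine (hg.div (hsum.mono_left nhdsWithin_le_nhds) h2).congr' ?_
  filter_upwards [nhdsWithin_le_nhds h, nhdsWithin_le_nhds (hsum.eventually_ne h2)] with y hy hy'
  have hx := h.self_of_nhds
  simp only [Pi.div_apply, slope_def_field, ← hy, ← hx]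
  rw [div_div, mul_comm, ← div_div]
  congr 1
  rw [div_eq_iff hy']
  ring

theorem hasDerivAt_div_of_sq_eq {k g : ℂ → ℂ} {x g' : ℂ} (w : ℂ) (hk : ContinuousAt k x)
    (hg : HasDerivAt g g' x) (h : ∀ᶠ y in 𝓝 x, k y ^ 2 = g y) (h0 : k x ≠ 0) :
    HasDerivAt (fun y => w / k y) (-(w * g') / (2 * g x * k x)) x := by
  refine ((hasDerivAt_const x w).div (hasDerivAt_of_sq_eq hk hg h h0) h0).congr_deriv ?_
  rw [← h.self_of_nhds]
  field_simp
  ring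

/-! ### Branches of the root in the annulus between the cuts -/

theorem mem_cutPlane_of_norm_lt {r s z : ℂ} (hr : ‖r‖ < ‖z‖ ^ 2) (hs : ‖z‖ ^ 2 < ‖s‖) :
    z ∈ cutPlane r s := by
  refine ⟨fun t ht0 ht1 h => ?_, fun t ht h => ?_⟩
  · have := congrArg norm h
    rw [norm_pow, norm_mul, Complex.norm_real, Real.norm_of_nonneg ht0] at this
    nlinarith [norm_nonneg r]
  · have := congrArg norm h
    rw [norm_pow, norm_mul, Complex.norm_real, Real.norm_of_nonneg (by linarith)] at this
    nlinarith [norm_nonneg s]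

theorem sq_sub_ne_zero_of_norm_lt {r z : ℂ} (hr : ‖r‖ < ‖z‖ ^ 2) : z ^ 2 - r ≠ 0 := by
  intro h
  rw [sub_eq_zero] at h
  rw [← h, norm_pow] at hr
  exact lt_irrefl _ hr

theorem sq_sub_ne_zero_of_lt_norm {s z : ℂ} (hs : ‖z‖ ^ 2 < ‖s‖) : z ^ 2 - s ≠ 0 := by
  intro h
  rw [sub_eq_zero] at h
  rw [← h, norm_pow] at hs
  exact lt_irrefl _ hs

section Branch

variable {W : Set (ℂ × ℂ)} {R : ℂ → ℂ → ℂ → ℂ} {r s z : ℂ}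

theorem IsRootBranch.sq_eq_of_norm_lt (hR : IsRootBranch W R) (h : (r, s) ∈ W)
    (hr : ‖r‖ < ‖z‖ ^ 2) (hs : ‖z‖ ^ 2 < ‖s‖) :
    R r s z ^ 2 = (z ^ 2 - r) * (z ^ 2 - s) :=
  hR.sq_eq r s h z (mem_cutPlane_of_norm_lt hr hs)

theorem IsRootBranch.ne_zero (hR : IsRootBranch W R) (h : (r, s) ∈ W)
    (hr : ‖r‖ < ‖z‖ ^ 2) (hs : ‖z‖ ^ 2 < ‖s‖) : R r s z ≠ 0 := by
  intro h0
  have := hR.sq_eq_of_norm_lt h hr hs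
  rw [h0, zero_pow two_ne_zero] at this
  exact mul_ne_zero (sq_sub_ne_zero_of_norm_lt hr) (sq_sub_ne_zero_of_lt_norm hs) this.symm

/-- The domain of a branch is a neighbourhood of each of its points in the annulus, so the branch is
jointly continuous there in the unrestricted sense. -/
theorem IsRootBranch.continuousAt (hR : IsRootBranch W R) (hW : IsOpen W) (h : (r, s) ∈ W)
    (hr : ‖r‖ < ‖z‖ ^ 2) (hs : ‖z‖ ^ 2 < ‖s‖) :
    ContinuousAt (fun q : (ℂ × ℂ) × ℂ => R q.1.1 q.1.2 q.2) ((r, s), z) := by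
  refine hR.continuousOn.continuousAt ?_
  have ho : IsOpen {q : (ℂ × ℂ) × ℂ | q.1 ∈ W ∧ ‖q.1.1‖ < ‖q.2‖ ^ 2 ∧ ‖q.2‖ ^ 2 < ‖q.1.2‖} := by
    simp only [ofPred_and]
    exact (hW.preimage continuous_fst).inter
      ((isOpen_lt (by fun_prop) (by fun_prop)).inter (isOpen_lt (by fun_prop) (by fun_prop)))
  exact mem_of_superset (ho.mem_nhds ⟨h, hr, hs⟩)
    fun q hq => ⟨hq.1, mem_cutPlane_of_norm_lt hq.2.1 hq.2.2⟩

variable {ρ : ℝ}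

theorem IsRootBranch.hasDerivAt_circleIntegral_fst (hR : IsRootBranch W R) (hW : IsOpen W)
    (hρ : 0 ≤ ρ) (hWρ : ∀ r s : ℂ, (r, s) ∈ W → ‖r‖ < ρ ^ 2 ∧ ρ ^ 2 < ‖s‖) (h : (r, s) ∈ W)
    {f : ℂ → ℂ} (hf : ContinuousOn f (Metric.sphere 0 ρ)) :
    HasDerivAt (fun r' => ∮ z in C(0, ρ), f z / R r' s z)
      (∮ z in C(0, ρ), f z / (2 * (z ^ 2 - r) * R r s z)) r := by
  have hU : {r' | (r', s) ∈ W} ∈ 𝓝 r :=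
    (hW.preimage (by fun_prop : Continuous fun r' : ℂ => (r', s))).mem_nhds h
  refine hasDerivAt_circleIntegral_of_continuousOn hρ hU ?_ ?_ ?_
    (K' := fun r z => f z / (2 * (z ^ 2 - r) * R r s z))
  · intro x hx z hz
    obtain ⟨h1, h2⟩ := hWρ _ _ hx
    have hn : ‖z‖ = ρ := by simpa using hz
    rw [← hn] at h1 h2
    refine (hf z hz).div (ContinuousAt.continuousWithinAt ?_) (hR.ne_zero hx h1 h2)
    exact (hR.continuousAt hW hx h1 h2).comp (f := fun z => ((x, s), z)) (by fun_prop)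
  · rintro ⟨x, z⟩ ⟨hx, hz⟩
    obtain ⟨h1, h2⟩ := hWρ _ _ hx
    have hn : ‖z‖ = ρ := by simpa using hz
    rw [← hn] at h1 h2
    refine ContinuousWithinAt.div ?_ (ContinuousAt.continuousWithinAt ?_) ?_
    · exact (hf z hz).comp (f := fun q : ℂ × ℂ => q.2) (by fun_prop) fun q hq => hq.2
    · refine ContinuousAt.mul (by fun_prop) ?_
      exact (hR.continuousAt hW hx h1 h2).comp (x := (x, z))
        (f := fun q : ℂ × ℂ => ((q.1, s), q.2)) (by fun_prop)
    · exact mul_ne_zero (mul_ne_zero two_ne_zero (sq_sub_ne_zero_of_norm_lt h1))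
        (hR.ne_zero hx h1 h2)
  · intro x hx z hz
    obtain ⟨h1, h2⟩ := hWρ _ _ hx
    have hn : ‖z‖ = ρ := by simpa using hz
    have hev : ∀ᶠ y in 𝓝 x, R y s z ^ 2 = (z ^ 2 - y) * (z ^ 2 - s) := by
      filter_upwards [(hW.preimage (by fun_prop : Continuous fun r' : ℂ => (r', s))).mem_nhds hx]
        with y hy
      obtain ⟨h1, h2⟩ := hWρ _ _ hy
      rw [← hn] at h1 h2
      exact hR.sq_eq_of_norm_lt hy h1 h2
    rw [← hn] at h1 h2
    have hc : ContinuousAt (fun y => R y s z) x :=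
      (hR.continuousAt hW hx h1 h2).comp (f := fun y => ((y, s), z)) (by fun_prop)
    have hg : HasDerivAt (fun y : ℂ => (z ^ 2 - y) * (z ^ 2 - s)) (-1 * (z ^ 2 - s)) x :=
      ((hasDerivAt_id x).const_sub (z ^ 2)).mul_const _
    have h3 := sq_sub_ne_zero_of_norm_lt h1
    have h4 := sq_sub_ne_zero_of_lt_norm h2
    have h5 := hR.ne_zero hx h1 h2
    refine (hasDerivAt_div_of_sq_eq (f z) hc hg hev h5).congr_deriv ?_
    field_simp

theorem IsRootBranch.hasDerivAt_circleIntegral_snd (hR : IsRootBranch W R) (hW : IsOpen W)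
    (hρ : 0 ≤ ρ) (hWρ : ∀ r s : ℂ, (r, s) ∈ W → ‖r‖ < ρ ^ 2 ∧ ρ ^ 2 < ‖s‖) (h : (r, s) ∈ W)
    {f : ℂ → ℂ} (hf : ContinuousOn f (Metric.sphere 0 ρ)) :
    HasDerivAt (fun s' => ∮ z in C(0, ρ), f z / R r s' z)
      (∮ z in C(0, ρ), f z / (2 * (z ^ 2 - s) * R r s z)) s := by
  have hU : {s' | (r, s') ∈ W} ∈ 𝓝 s :=
    (hW.preimage (by fun_prop : Continuous fun s' : ℂ => (r, s'))).mem_nhds h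
  refine hasDerivAt_circleIntegral_of_continuousOn hρ hU ?_ ?_ ?_
    (K' := fun s z => f z / (2 * (z ^ 2 - s) * R r s z))
  · intro x hx z hz
    obtain ⟨h1, h2⟩ := hWρ _ _ hx
    have hn : ‖z‖ = ρ := by simpa using hz
    rw [← hn] at h1 h2
    refine (hf z hz).div (ContinuousAt.continuousWithinAt ?_) (hR.ne_zero hx h1 h2)
    exact (hR.continuousAt hW hx h1 h2).comp (f := fun z => ((r, x), z)) (by fun_prop)
  · rintro ⟨x, z⟩ ⟨hx, hz⟩
    obtain ⟨h1, h2⟩ := hWρ _ _ hx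
    have hn : ‖z‖ = ρ := by simpa using hz
    rw [← hn] at h1 h2
    refine ContinuousWithinAt.div ?_ (ContinuousAt.continuousWithinAt ?_) ?_
    · exact (hf z hz).comp (f := fun q : ℂ × ℂ => q.2) (by fun_prop) fun q hq => hq.2
    · refine ContinuousAt.mul (by fun_prop) ?_
      exact (hR.continuousAt hW hx h1 h2).comp (x := (x, z))
        (f := fun q : ℂ × ℂ => ((r, q.1), q.2)) (by fun_prop)
    · exact mul_ne_zero (mul_ne_zero two_ne_zero (sq_sub_ne_zero_of_lt_norm h2))
        (hR.ne_zero hx h1 h2)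
  · intro x hx z hz
    obtain ⟨h1, h2⟩ := hWρ _ _ hx
    have hn : ‖z‖ = ρ := by simpa using hz
    have hev : ∀ᶠ y in 𝓝 x, R r y z ^ 2 = (z ^ 2 - r) * (z ^ 2 - y) := by
      filter_upwards [(hW.preimage (by fun_prop : Continuous fun s' : ℂ => (r, s'))).mem_nhds hx]
        with y hy
      obtain ⟨h1, h2⟩ := hWρ _ _ hy
      rw [← hn] at h1 h2
      exact hR.sq_eq_of_norm_lt hy h1 h2
    rw [← hn] at h1 h2
    have hc : ContinuousAt (fun y => R r y z) x :=
      (hR.continuousAt hW hx h1 h2).comp (f := fun y => ((r, y), z)) (by fun_prop)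
    have hg : HasDerivAt (fun y : ℂ => (z ^ 2 - r) * (z ^ 2 - y)) ((z ^ 2 - r) * -1) x :=
      ((hasDerivAt_id x).const_sub (z ^ 2)).const_mul _
    have h3 := sq_sub_ne_zero_of_norm_lt h1
    have h4 := sq_sub_ne_zero_of_lt_norm h2
    have h5 := hR.ne_zero hx h1 h2
    refine (hasDerivAt_div_of_sq_eq (f z) hc hg hev h5).congr_deriv ?_
    field_simp

/-- Integration by parts: `z ((a r + b) ∂/∂r + (a s + b) ∂/∂s)` and `-½ d/dz ((a z² + b) ·)` have
the same effect on the reciprocal of the root. -/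
theorem IsRootBranch.circleIntegral_by_parts (hR : IsRootBranch W R) (hW : IsOpen W)
    (hρ : 0 ≤ ρ) (h : (r, s) ∈ W) (hr : ‖r‖ < ρ ^ 2) (hs : ρ ^ 2 < ‖s‖)
    {φ φ' : ℂ → ℂ} (hφ : ∀ z ∈ Metric.sphere (0 : ℂ) ρ, HasDerivAt φ (φ' z) z)
    (hφ' : ContinuousOn φ' (Metric.sphere 0 ρ)) (a b : ℂ) :
    (a * r + b) * (∮ z in C(0, ρ), z * φ z / (2 * (z ^ 2 - r) * R r s z)) +
      (a * s + b) * (∮ z in C(0, ρ), z * φ z / (2 * (z ^ 2 - s) * R r s z)) =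
    2⁻¹ * ∮ z in C(0, ρ), (a * z ^ 2 + b) * φ' z / R r s z := by
  have hn : ∀ z ∈ Metric.sphere (0 : ℂ) ρ, ‖r‖ < ‖z‖ ^ 2 ∧ ‖z‖ ^ 2 < ‖s‖ := by
    intro z hz
    have : ‖z‖ = ρ := by simpa using hz
    rw [this]
    exact ⟨hr, hs⟩
  have hφc : ContinuousOn φ (Metric.sphere 0 ρ) :=
    fun z hz => (hφ z hz).continuousAt.continuousWithinAt
  have hc : ∀ z ∈ Metric.sphere (0 : ℂ) ρ, ContinuousAt (R r s) z := fun z hz =>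
    (hR.continuousAt hW h (hn z hz).1 (hn z hz).2).comp (f := fun z => ((r, s), z)) (by fun_prop)
  have hRc : ContinuousOn (R r s) (Metric.sphere 0 ρ) :=
    fun z hz => (hc z hz).continuousWithinAt
  have hR0 : ∀ z ∈ Metric.sphere (0 : ℂ) ρ, R r s z ≠ 0 :=
    fun z hz => hR.ne_zero h (hn z hz).1 (hn z hz).2
  have hr0 : ∀ z ∈ Metric.sphere (0 : ℂ) ρ, z ^ 2 - r ≠ 0 :=
    fun z hz => sq_sub_ne_zero_of_norm_lt (hn z hz).1
  have hs0 : ∀ z ∈ Metric.sphere (0 : ℂ) ρ, z ^ 2 - s ≠ 0 :=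
    fun z hz => sq_sub_ne_zero_of_lt_norm (hn z hz).2
  have hint : ∀ u : ℂ, (∀ z ∈ Metric.sphere (0 : ℂ) ρ, z ^ 2 - u ≠ 0) →
      CircleIntegrable (fun z => z * φ z / (2 * (z ^ 2 - u) * R r s z)) 0 ρ := by
    intro u hu
    refine ContinuousOn.circleIntegrable hρ (ContinuousOn.div (by fun_prop) (by fun_prop) ?_)
    exact fun z hz => mul_ne_zero (mul_ne_zero two_ne_zero (hu z hz)) (hR0 z hz)
  have hint' : CircleIntegrable (fun z => (a * z ^ 2 + b) * φ' z / R r s z) 0 ρ :=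
    ContinuousOn.circleIntegrable hρ (ContinuousOn.div (by fun_prop) hRc hR0)
  have key : ∮ z in C(0, ρ), (2⁻¹ * ((a * z ^ 2 + b) * φ' z / R r s z) -
      ((a * r + b) * (z * φ z / (2 * (z ^ 2 - r) * R r s z)) +
      (a * s + b) * (z * φ z / (2 * (z ^ 2 - s) * R r s z)))) = 0 := by
    refine circleIntegral.integral_eq_zero_of_hasDerivWithinAt
      (f := fun z => 2⁻¹ * ((a * z ^ 2 + b) * φ z / R r s z)) hρ fun z hz => ?_
    refine HasDerivAt.hasDerivWithinAt ?_
    have hev : ∀ᶠ y in 𝓝 z, R r s y ^ 2 = (y ^ 2 - r) * (y ^ 2 - s) := by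
      have ho : IsOpen {y : ℂ | ‖r‖ < ‖y‖ ^ 2 ∧ ‖y‖ ^ 2 < ‖s‖} := by
        simp only [ofPred_and]
        exact (isOpen_lt (by fun_prop) (by fun_prop)).inter
          (isOpen_lt (by fun_prop) (by fun_prop))
      filter_upwards [ho.mem_nhds (hn z hz)] with y hy
      exact hR.sq_eq_of_norm_lt h hy.1 hy.2
    have hq : ∀ u : ℂ, HasDerivAt (fun y : ℂ => y ^ 2 - u) (2 * z) z := fun u => by
      simpa using (hasDerivAt_pow 2 z).sub_const u
    have hp : HasDerivAt (fun y : ℂ => a * y ^ 2 + b) (a * (2 * z)) z := by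
      simpa using ((hasDerivAt_pow 2 z).const_mul a).add_const b
    have hRd := hasDerivAt_of_sq_eq (hc z hz) ((hq r).mul (hq s)) hev (hR0 z hz)
    refine (((hp.mul (hφ z hz)).div hRd (hR0 z hz)).const_mul 2⁻¹).congr_deriv ?_
    have h1 := hr0 z hz
    have h2 := hs0 z hz
    have h3 := hR0 z hz
    have h4 : R r s z ^ 2 = (z ^ 2 - r) * (z ^ 2 - s) := hev.self_of_nhds
    have h5 : 2 * R r s z ≠ 0 := mul_ne_zero two_ne_zero h3
    simp only [Pi.mul_apply]
    have h6 : (2 * z * (z ^ 2 - s) + (z ^ 2 - r) * (2 * z)) / (2 * R r s z) =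
        z * R r s z * ((z ^ 2 - r)⁻¹ + (z ^ 2 - s)⁻¹) := by
      rw [div_eq_iff h5]
      have : z * R r s z * ((z ^ 2 - r)⁻¹ + (z ^ 2 - s)⁻¹) * (2 * R r s z) =
        2 * z * ((z ^ 2 - r)⁻¹ + (z ^ 2 - s)⁻¹) * R r s z ^ 2 := by ring
      rw [this, h4]
      field_simp
    rw [h6]
    field_simp
    ring
  rw [circleIntegral.integral_sub, circleIntegral.integral_add] at key
  · simp only [circleIntegral.integral_const_mul] at key
    linear_combination -key
  all_goals simp only [← smul_eq_mul]
  · exact (hint r hr0).const_smul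
  · exact (hint s hs0).const_smul
  · exact hint'.const_smul
  · exact ((hint r hr0).const_smul).add ((hint s hs0).const_smul)

end Branch

/-! ### The reciprocal square root `(1 - w)^{-1/2}` -/

/-- The principal branch of `(1 - w)^{-1/2}`, holomorphic on the unit disc. -/
noncomputable def rsqrtOneSub (w : ℂ) : ℂ := 1 / (1 - w) ^ (1 / 2 : ℂ)

theorem one_sub_mem_slitPlane {w : ℂ} (hw : ‖w‖ < 1) : 1 - w ∈ Complex.slitPlane := by
  rw [sub_eq_add_neg]
  exact Complex.mem_slitPlane_of_norm_lt_one (by simpa using hw)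

theorem rsqrtOneSub_zero : rsqrtOneSub 0 = 1 := by simp [rsqrtOneSub]

theorem rsqrtOneSub_sq (w : ℂ) : rsqrtOneSub w ^ 2 = (1 - w)⁻¹ := by
  rw [rsqrtOneSub, div_pow, one_pow, ← Complex.cpow_nat_mul]
  norm_num

theorem differentiableOn_rsqrtOneSub : DifferentiableOn ℂ rsqrtOneSub (Metric.ball 0 1) := by
  intro w hw
  have hw' : ‖w‖ < 1 := by simpa using hw
  have hs := one_sub_mem_slitPlane hw'
  refine DifferentiableAt.differentiableWithinAt ?_
  refine (differentiableAt_const 1).div ?_ ?_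
  · exact ((differentiableAt_id.const_sub 1).cpow (differentiableAt_const _) hs)
  · rw [Complex.cpow_ne_zero_iff]
    exact Or.inl (Complex.slitPlane_ne_zero hs)

/-- The binomial coefficients of `(1 - w)^{-1/2}` are nonzero, being quotients of a rising factorial
of `1/2` by a factorial. -/
theorem ringChoose_half_add_ne_zero (n : ℕ) : Ring.choose ((1 / 2 : ℂ) + n - 1) n ≠ 0 := by
  have h : ((1 / 2 : ℂ) + n - 1) = (((1 / 2 : ℝ) + n - 1 : ℝ) : ℂ) := by push_cast; ring
  rw [h, ← Complex.ofReal_choose, Complex.ofReal_ne_zero]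
  intro h0
  have h1 := Ring.factorial_nsmul_multichoose_eq_ascPochhammer ((1 / 2 : ℝ)) n
  have h2 : Ring.multichoose (1 / 2 : ℝ) n = 0 := by
    rw [Ring.choose] at h0
    rwa [show (1 / 2 : ℝ) + n - 1 - n + 1 = 1 / 2 by ring] at h0
  rw [h2, smul_zero, Polynomial.ascPochhammer_smeval_eq_eval] at h1
  exact (ascPochhammer_pos n (1 / 2 : ℝ) (by norm_num)).ne h1

theorem hasFPowerSeriesOnBall_rsqrtOneSub :
    HasFPowerSeriesOnBall rsqrtOneSub
      (.ofScalars ℂ fun n => Ring.choose ((1 / 2 : ℂ) + n - 1) n) 0 1 :=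
  Complex.one_div_one_sub_cpow_hasFPowerSeriesOnBall_zero (1 / 2)

/-- A circle integral with the kernel `(1 - x h(z))^{-1/2}` is holomorphic in `x` as long as
`x h(z)` stays in the unit disc. -/
theorem differentiableOn_circleIntegral_rsqrtOneSub {g h : ℂ → ℂ} {ρ A : ℝ} (hρ : 0 ≤ ρ)
    (hg : ContinuousOn g (Metric.sphere 0 ρ)) (hh : ContinuousOn h (Metric.sphere 0 ρ))
    (hA : ∀ z ∈ Metric.sphere (0 : ℂ) ρ, A * ‖h z‖ ≤ 1) :
    DifferentiableOn ℂ (fun x => ∮ z in C(0, ρ), g z * rsqrtOneSub (x * h z))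
      (Metric.ball 0 A) := by
  have hmem : ∀ x ∈ Metric.ball (0 : ℂ) A, ∀ z ∈ Metric.sphere (0 : ℂ) ρ,
      x * h z ∈ Metric.ball (0 : ℂ) 1 := by
    intro x hx z hz
    rw [mem_ball_zero_iff] at hx ⊢
    rw [norm_mul]
    rcases (norm_nonneg (h z)).eq_or_lt with h0 | h0
    · rw [← h0]; simp
    · exact (mul_lt_mul_of_pos_right hx h0).trans_le (hA z hz)
  intro x₀ hx₀
  refine HasDerivAt.differentiableAt (f' := ∮ z in C(0, ρ),
    g z * (deriv rsqrtOneSub (x₀ * h z) * h z)) ?_ |>.differentiableWithinAt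
  refine hasDerivAt_circleIntegral_of_continuousOn hρ (Metric.isOpen_ball.mem_nhds hx₀)
    (K' := fun x z => g z * (deriv rsqrtOneSub (x * h z) * h z)) ?_ ?_ ?_
  · intro x hx
    exact hg.mul (differentiableOn_rsqrtOneSub.continuousOn.comp (continuousOn_const.mul hh)
      (hmem x hx))
  · have hg' : ContinuousOn (fun q : ℂ × ℂ => g q.2)
        (Metric.ball 0 A ×ˢ Metric.sphere 0 ρ) :=
      hg.comp continuousOn_snd fun q hq => hq.2
    have hh' : ContinuousOn (fun q : ℂ × ℂ => h q.2)
        (Metric.ball 0 A ×ˢ Metric.sphere 0 ρ) :=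
      hh.comp continuousOn_snd fun q hq => hq.2
    have hd := (differentiableOn_rsqrtOneSub.deriv Metric.isOpen_ball).continuousOn
    exact hg'.mul ((hd.comp (continuousOn_fst.mul hh') fun q hq => hmem _ hq.1 _ hq.2).mul hh')
  · intro x hx z hz
    have hd := (differentiableOn_rsqrtOneSub.differentiableAt
      (Metric.isOpen_ball.mem_nhds (hmem x hx z hz))).hasDerivAt
    have hm : HasDerivAt (fun x : ℂ => x * h z) (h z) x := by
      simpa using (hasDerivAt_id x).mul_const (h z)
    exact (hd.comp x hm).const_mul (g z)

/-! ### Circle averages against the kernel determine an even function -/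

theorem circleAverage_comp_neg (f : ℂ → ℂ) (ρ : ℝ) :
    circleAverage (fun z => f (-z)) 0 ρ = circleAverage f 0 ρ := by
  rw [← circleAverage_neg_radius (f := f)]
  simp [circleAverage_def, circleMap]

theorem circleAverage_comp_inv (f : ℂ → ℂ) (ρ : ℝ) :
    circleAverage (fun z => f z⁻¹) 0 ρ = circleAverage f 0 ρ⁻¹ := by
  rw [circleAverage_eq_circleAverage_zero_one, circleAverage_eq_circleAverage_zero_one (R := ρ⁻¹),
    ← circleAverage_zero_one_congr_inv]
  simp [mul_comm]

/-- The averages of `f(z) (1 - r/z²)^{-1/2}` over a circle form a power series in `r` whose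
coefficients are nonzero multiples of the even Laurent coefficients of `f` on that circle; for `f`
holomorphic in the disc these are its even Taylor coefficients. -/
theorem hasSum_circleAverage_mul_rsqrtOneSub {f : ℂ → ℂ} {ρ : ℝ} (hρ : 0 < ρ)
    (hf : ContinuousOn f (Metric.sphere 0 ρ)) {r : ℂ} (hr : ‖r‖ < ρ ^ 2) :
    HasSum (fun n : ℕ => r ^ n * (Ring.choose ((1 / 2 : ℂ) + n - 1) n *
        circleAverage (fun z => f z * (z⁻¹) ^ (2 * n)) 0 ρ))
      (circleAverage (fun z => f z * rsqrtOneSub (r * (z⁻¹) ^ 2)) 0 ρ) := by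
  set c : ℕ → ℂ := fun n => Ring.choose ((1 / 2 : ℂ) + n - 1) n with hcdef
  have hseries : ∀ w : ℂ, ‖w‖ < 1 → HasSum (fun n => c n * w ^ n) (rsqrtOneSub w) := by
    intro w hw
    have := hasFPowerSeriesOnBall_rsqrtOneSub.hasSum (y := w) (by
      rw [Metric.mem_eball, edist_zero_right]
      rw [← ENNReal.coe_one]
      exact_mod_cast hw)
    simpa [FormalMultilinearSeries.ofScalars_apply_eq, hcdef, mul_comm] using this
  obtain ⟨B, hB⟩ := (isCompact_sphere (0 : ℂ) ρ).exists_bound_of_continuousOn hf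
  set q : ℝ := ‖r‖ / ρ ^ 2 with hq
  have hq1 : q < 1 := by rw [hq, div_lt_one (by positivity)]; exact hr
  have hq0 : 0 ≤ q := by positivity
  have hsum : Summable fun n => B * (‖c n‖ * q ^ n) := by
    refine Summable.mul_left _ ?_
    have h1 := (hseries (q : ℂ) (by simpa [abs_of_nonneg hq0] using hq1)).summable.norm
    refine h1.congr fun n => ?_
    simp [abs_of_nonneg hq0]
  have hcont : ∀ g : ℂ → ℂ, ContinuousOn g (Metric.sphere 0 ρ) →
      Continuous fun θ : ℝ => g (circleMap 0 ρ θ) := fun g hg =>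
    hg.comp_continuous (continuous_circleMap 0 ρ) fun θ => circleMap_mem_sphere 0 hρ.le θ
  have hne : ∀ z ∈ Metric.sphere (0 : ℂ) ρ, z ≠ 0 := fun z hz => Metric.ne_of_mem_sphere hz hρ.ne'
  have hterm : ∀ n : ℕ, ContinuousOn (fun z => f z * (z⁻¹) ^ (2 * n)) (Metric.sphere 0 ρ) :=
    fun n => hf.mul ((continuousOn_id.inv₀ hne).pow _)
  have hnorm : ∀ θ : ℝ, ‖circleMap 0 ρ θ‖ = ρ := fun θ => by simp [abs_of_pos hρ]
  have main := intervalIntegral.hasSum_integral_of_dominated_convergence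
    (μ := MeasureTheory.volume) (a := 0) (b := 2 * π)
    (F := fun (n : ℕ) θ => r ^ n * (c n * (f (circleMap 0 ρ θ) * (circleMap 0 ρ θ)⁻¹ ^ (2 * n))))
    (f := fun θ => f (circleMap 0 ρ θ) * rsqrtOneSub (r * (circleMap 0 ρ θ)⁻¹ ^ 2))
    (fun n _ => B * (‖c n‖ * q ^ n))
    (fun n => (continuous_const.mul (continuous_const.mul
      (hcont _ (hterm n)))).aestronglyMeasurable)
    (fun n => Eventually.of_forall fun θ _ => ?_)
    (Eventually.of_forall fun θ _ => hsum) intervalIntegrable_const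
    (Eventually.of_forall fun θ _ => ?_)
  · have h2 := main.const_smul ((2 * π)⁻¹ : ℝ)
    simp only [circleAverage_def]
    refine (congrArg (fun g : ℕ → ℂ => HasSum g _) (funext fun n => ?_)).mp h2
    rw [intervalIntegral.integral_const_mul, intervalIntegral.integral_const_mul]
    simp only [Complex.real_smul]
    ring
  · have h1 := hB _ (circleMap_mem_sphere 0 hρ.le θ)
    have h3 : ‖r ^ n * (c n * (f (circleMap 0 ρ θ) * (circleMap 0 ρ θ)⁻¹ ^ (2 * n)))‖ =
        ‖f (circleMap 0 ρ θ)‖ * (‖c n‖ * q ^ n) := by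
      simp only [norm_mul, norm_pow, norm_inv, hnorm, hq, div_pow, pow_mul]
      ring
    rw [h3]
    gcongr
  · have h1 : ‖r * (circleMap 0 ρ θ)⁻¹ ^ 2‖ < 1 := by
      rw [norm_mul, norm_pow, norm_inv, hnorm, inv_pow, ← div_eq_mul_inv]
      exact hq1
    have h2 := (hseries _ h1).mul_left (f (circleMap 0 ρ θ))
    refine (congrArg (fun g : ℕ → ℂ => HasSum g _) (funext fun n => ?_)).mp h2
    rw [mul_pow, ← pow_mul]
    ring

theorem circleAverage_eq_of_differentiableOn {f : ℂ → ℂ} {δ ρ : ℝ} (hρ : 0 < ρ) (hρδ : ρ < δ)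
    (hf : DifferentiableOn ℂ f (Metric.ball 0 δ)) : circleAverage f 0 ρ = f 0 := by
  refine DiffContOnCl.circleAverage ?_
  rw [abs_of_pos hρ]
  exact (hf.mono (Metric.closedBall_subset_ball hρδ)).diffContOnCl_ball Subset.rfl

/-- A function that is even and holomorphic on a disc is constant if its averages against
`(1 - r/z²)^{-1/2}` over a circle do not depend on `r`: the even Taylor coefficients of positive
degree vanish because the averages form a constant power series, the odd ones by symmetry. -/
theorem eqOn_const_of_circleAverage_mul_rsqrtOneSub {f : ℂ → ℂ} {δ ρ : ℝ} {k : ℂ} (hρ : 0 < ρ)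
    (hρδ : ρ < δ) (hf : DifferentiableOn ℂ f (Metric.ball 0 δ))
    (heven : ∀ z ∈ Metric.ball (0 : ℂ) δ, f (-z) = f z)
    (hk : ∀ r : ℂ, ‖r‖ < ρ ^ 2 →
      circleAverage (fun z => f z * rsqrtOneSub (r * (z⁻¹) ^ 2)) 0 ρ = k) :
    EqOn f (fun _ => k) (Metric.ball 0 δ) := by
  have hsub : Metric.sphere (0 : ℂ) ρ ⊆ Metric.ball 0 δ :=
    Metric.sphere_subset_closedBall.trans (Metric.closedBall_subset_ball hρδ)
  have hfc : ContinuousOn f (Metric.sphere 0 ρ) := hf.continuousOn.mono hsub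
  have hf0 : f 0 = k := by
    rw [← hk 0 (by simpa using pow_pos hρ 2), ← circleAverage_eq_of_differentiableOn hρ hρδ hf]
    simp [rsqrtOneSub_zero]
  -- the coefficients of even positive degree
  have hcoef : ∀ n : ℕ, n ≠ 0 → circleAverage (fun z => f z * (z⁻¹) ^ (2 * n)) 0 ρ = 0 := by
    intro n hn
    set c : ℕ → ℂ := fun n : ℕ => Ring.choose ((1 / 2 : ℂ) + n - 1) n *
        circleAverage (fun z => f z * (z⁻¹) ^ (2 * n)) 0 ρ with hc
    have h1 : HasFPowerSeriesAt (fun _ : ℂ => k)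
        (FormalMultilinearSeries.ofScalars ℂ c) 0 := by
      rw [hasFPowerSeriesAt_iff]
      filter_upwards [Metric.ball_mem_nhds (0 : ℂ) (by positivity : 0 < ρ ^ 2)] with r hr
      have hr' : ‖r‖ < ρ ^ 2 := by simpa using hr
      have := hasSum_circleAverage_mul_rsqrtOneSub hρ hfc hr'
      rw [hk r hr'] at this
      simpa [FormalMultilinearSeries.coeff_ofScalars, hc] using this
    have h2 := h1.eq_formalMultilinearSeries (hasFPowerSeriesAt_const (c := k) (e := (0 : ℂ)))
    have h3 : c n = 0 := by
      rw [← FormalMultilinearSeries.coeff_ofScalars (p := c) (n := n) (𝕜 := ℂ), h2,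
        FormalMultilinearSeries.coeff, constFormalMultilinearSeries_apply_of_nonzero hn]
      rfl
    exact (mul_eq_zero.1 h3).resolve_left (ringChoose_half_add_ne_zero n)
  have hcoef' : ∀ m : ℕ, m ≠ 0 → circleAverage (fun z => f z * (z⁻¹) ^ m) 0 ρ = 0 := by
    intro m hm
    rcases Nat.even_or_odd m with he | ho
    · obtain ⟨n, rfl⟩ := he.two_dvd
      exact hcoef n (by rintro rfl; exact hm rfl)
    · have h1 := circleAverage_comp_neg (fun z => f z * (z⁻¹) ^ m) ρ
      have h2 : circleAverage (fun z => f (-z) * ((-z)⁻¹) ^ m) 0 ρ =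
          circleAverage (fun z => (-1 : ℂ) • (f z * (z⁻¹) ^ m)) 0 ρ := by
        refine circleAverage_congr_sphere fun z hz => ?_
        rw [abs_of_pos hρ] at hz
        simp only [heven z (hsub hz), inv_neg, ho.neg_pow, smul_eq_mul]
        ring
      rw [h2, circleAverage_fun_smul] at h1
      simp only [smul_eq_mul, neg_mul, one_mul] at h1
      exact self_eq_neg.1 h1.symm
  have hser : ∀ z ∈ Metric.ball (0 : ℂ) ρ, f z = k := by
    intro z hz
    lift ρ to NNReal using hρ.le
    have h1 := (hf.mono (Metric.closedBall_subset_ball hρδ)).hasFPowerSeriesOnBall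
      (by exact_mod_cast hρ)
    have h2 := h1.hasSum (y := z) (by simpa [← Metric.eball_coe] using hz)
    rw [zero_add] at h2
    have h3 := hasSum_single (f := fun n => (cauchyPowerSeries f 0 ρ n) fun _ => z) 0 (by
      intro m hm
      rw [cauchyPowerSeries_apply]
      have h4 := hcoef' m hm
      rw [circleAverage_eq_circleIntegral hρ.ne'] at h4
      have h5 : (∮ w in C(0, ρ), (z / (w - 0)) ^ m • (w - 0)⁻¹ • f w) =
          z ^ m * ∮ w in C(0, ρ), (w - 0)⁻¹ • (f w * (w⁻¹) ^ m) := by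
        rw [← circleIntegral.integral_const_mul]
        congr 1
        ext w
        simp only [sub_zero, smul_eq_mul, div_pow, inv_pow]
        ring
      rw [h5, smul_eq_mul, mul_left_comm, ← smul_eq_mul (_ : ℂ)⁻¹, h4, mul_zero])
    have h6 := h2.unique h3
    have h7 : (cauchyPowerSeries f 0 ρ 0) (fun _ => z) = f 0 := by
      rw [h1.coeff_zero]
    rw [h6, h7, hf0]
  refine AnalyticOnNhd.eqOn_of_preconnected_of_eventuallyEq (z₀ := 0)
    (hf.analyticOnNhd Metric.isOpen_ball) analyticOnNhd_const
    (convex_ball (0 : ℂ) δ).isPreconnected (by simpa using hρ.trans hρδ) ?_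
  filter_upwards [Metric.ball_mem_nhds (0 : ℂ) hρ] with z hz using hser z hz

/-! ### Odd functions at the two points `0` and `∞` -/

section Odd

variable {δ : ℝ} {φ : ℂ → ℂ}

theorem isOpen_discZero (δ : ℝ) : IsOpen (discZero δ) := isOpen_lt continuous_norm continuous_const

theorem isOpen_discInfty (δ : ℝ) : IsOpen (discInfty δ) :=
  isOpen_lt continuous_const continuous_norm

theorem discZero_eq_ball (δ : ℝ) : discZero δ = Metric.ball 0 δ := by
  ext z; simp [discZero]

theorem IsOddHolomorphic.map_zero (hφ : IsOddHolomorphic δ φ) (hδ : 0 < δ) : φ 0 = 0 := by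
  have := hφ.odd 0 (Or.inl (by simpa [discZero] using hδ))
  rw [neg_zero] at this
  exact self_eq_neg.1 this

/-- In the coordinate `1/z` an odd holomorphic function extends over `∞`; since `0⁻¹ = 0` and the
function vanishes at `0` and at `∞`, the composition with `z⁻¹` is already this extension. -/
theorem IsOddHolomorphic.differentiableOn_comp_inv (hφ : IsOddHolomorphic δ φ) (hδ : 0 < δ) :
    DifferentiableOn ℂ (fun w => φ w⁻¹) (Metric.ball 0 δ) := by
  have hn : Metric.ball (0 : ℂ) δ ∈ 𝓝 (0 : ℂ) := Metric.ball_mem_nhds 0 hδ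
  rw [← Complex.differentiableOn_compl_singleton_and_continuousAt_iff hn]
  constructor
  · refine hφ.differentiableOn_infty.comp (fun w hw => ?_) fun w hw => ?_
    · exact (differentiableAt_inv hw.2).differentiableWithinAt
    · have h0 : 0 < ‖w‖ := norm_pos_iff.2 hw.2
      have h1 : ‖w‖ < δ := by simpa using hw.1
      rw [discInfty, mem_ofPred_eq, norm_inv]
      exact inv_strictAnti₀ h0 h1
  · rw [continuousAt_iff_punctured_nhds, inv_zero, hφ.map_zero hδ]
    exact hφ.tendsto_infty.comp tendsto_inv₀_nhdsNE_zero

theorem deriv_neg_of_odd_on {U : Set ℂ} (hU : IsOpen U) (h : ∀ z ∈ U, φ (-z) = -φ z) {z : ℂ}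
    (hz : z ∈ U) : deriv φ (-z) = deriv φ z := by
  have h1 : (fun y => φ (-y)) =ᶠ[𝓝 z] fun y => -φ y := by
    filter_upwards [hU.mem_nhds hz] with y hy using h y hy
  have h2 := h1.deriv_eq
  rw [deriv_comp_neg, deriv.fun_neg] at h2
  exact neg_injective h2

end Odd

/-! ### The identity theorem on a bidisc -/

/-- A separately holomorphic function on a bidisc that vanishes near a point vanishes everywhere. -/
theorem eq_zero_of_eventually_eq_zero_bidisc {L : ℂ → ℂ → ℂ} {A B : ℝ} {r₀ t₀ : ℂ}
    (h₁ : ∀ t ∈ Metric.ball (0 : ℂ) B, DifferentiableOn ℂ (fun r => L r t) (Metric.ball 0 A))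
    (h₂ : ∀ r ∈ Metric.ball (0 : ℂ) A, DifferentiableOn ℂ (L r) (Metric.ball 0 B))
    (hr₀ : r₀ ∈ Metric.ball (0 : ℂ) A) (ht₀ : t₀ ∈ Metric.ball (0 : ℂ) B)
    (h : ∀ᶠ p : ℂ × ℂ in 𝓝 (r₀, t₀), L p.1 p.2 = 0) {r t : ℂ}
    (hr : r ∈ Metric.ball (0 : ℂ) A) (ht : t ∈ Metric.ball (0 : ℂ) B) : L r t = 0 := by
  rw [nhds_prod_eq] at h
  obtain ⟨p, hp, q, hq, hpq⟩ := eventually_prod_iff.1 h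
  refine ((h₂ r hr).analyticOnNhd Metric.isOpen_ball).eqOn_zero_of_preconnected_of_eventuallyEq_zero
    (convex_ball 0 B).isPreconnected ht₀ ?_ ht
  filter_upwards [hq, Metric.isOpen_ball.mem_nhds ht₀] with t' ht' htB
  have hA := (h₁ t' htB).analyticOnNhd Metric.isOpen_ball
  refine hA.eqOn_zero_of_preconnected_of_eventuallyEq_zero (convex_ball 0 A).isPreconnected hr₀ ?_ hr
  filter_upwards [hp] with r' hr' using hpq hr' ht'

/-! ### Factorization of the root in the annulus -/

theorem isPreconnected_annulus {ρ₁ ρ₂ : ℝ} (h : 0 ≤ ρ₁) :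
    IsPreconnected {z : ℂ | ρ₁ ≤ ‖z‖ ∧ ‖z‖ ≤ ρ₂} := by
  have himg : {z : ℂ | ρ₁ ≤ ‖z‖ ∧ ‖z‖ ≤ ρ₂} =
      (fun p : ℝ × ℝ => circleMap 0 p.1 p.2) '' (Icc ρ₁ ρ₂ ×ˢ univ) := by
    ext z
    constructor
    · intro hz
      refine ⟨(‖z‖, z.arg), ⟨hz, mem_univ _⟩, ?_⟩
      simp [circleMap, Complex.norm_mul_exp_arg_mul_I]
    · rintro ⟨⟨t, θ⟩, ⟨ht, -⟩, rfl⟩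
      have h0 : 0 ≤ t := h.trans ht.1
      simpa [abs_of_nonneg h0] using ht
  rw [himg]
  refine (isPreconnected_Icc.prod isPreconnected_univ).image _ (Continuous.continuousOn ?_)
  unfold circleMap
  fun_prop

/-- In the annulus, the root equals `κ z (1 - r/z²)^{1/2} (1 - z²/s)^{1/2}` with `κ² = -s`, for a
sign of `κ` that is the same on the whole annulus. -/
theorem IsRootBranch.exists_mul_rsqrtOneSub_eq {W : Set (ℂ × ℂ)} {R : ℂ → ℂ → ℂ → ℂ} {r s : ℂ}
    (hR : IsRootBranch W R) (hW : IsOpen W) (h : (r, s) ∈ W) {ρ₁ ρ₂ : ℝ} (hρ₁ : 0 < ρ₁)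
    (hρ : ρ₁ ≤ ρ₂) (hr : ‖r‖ < ρ₁ ^ 2) (hs : ρ₂ ^ 2 < ‖s‖) :
    ∃ κ : ℂ, κ ≠ 0 ∧ ∀ z : ℂ, ρ₁ ≤ ‖z‖ → ‖z‖ ≤ ρ₂ →
      R r s z * (rsqrtOneSub (r * z⁻¹ ^ 2) * rsqrtOneSub (s⁻¹ * z ^ 2)) = κ * z := by
  set A : Set ℂ := {z : ℂ | ρ₁ ≤ ‖z‖ ∧ ‖z‖ ≤ ρ₂} with hA
  have hs0 : 0 < ‖s‖ := lt_of_le_of_lt (sq_nonneg _) hs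
  have hsne : s ≠ 0 := norm_pos_iff.1 hs0
  have hz0 : ∀ z ∈ A, z ≠ 0 := fun z hz => norm_pos_iff.1 (hρ₁.trans_le hz.1)
  have hzr : ∀ z ∈ A, ‖r‖ < ‖z‖ ^ 2 := fun z hz =>
    hr.trans_le (pow_le_pow_left₀ hρ₁.le hz.1 2)
  have hzs : ∀ z ∈ A, ‖z‖ ^ 2 < ‖s‖ := fun z hz =>
    (pow_le_pow_left₀ (norm_nonneg z) hz.2 2).trans_lt hs
  have hb1 : ∀ z ∈ A, r * z⁻¹ ^ 2 ∈ Metric.ball (0 : ℂ) 1 := fun z hz => by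
    rw [mem_ball_zero_iff, norm_mul, norm_pow, norm_inv, inv_pow, ← div_eq_mul_inv,
      div_lt_one (pow_pos (norm_pos_iff.2 (hz0 z hz)) 2)]
    exact hzr z hz
  have hb2 : ∀ z ∈ A, s⁻¹ * z ^ 2 ∈ Metric.ball (0 : ℂ) 1 := fun z hz => by
    rw [mem_ball_zero_iff, norm_mul, norm_pow, norm_inv, mul_comm, ← div_eq_mul_inv,
      div_lt_one hs0]
    exact hzs z hz
  set k : ℂ → ℂ := fun z =>
    R r s z * (rsqrtOneSub (r * z⁻¹ ^ 2) * rsqrtOneSub (s⁻¹ * z ^ 2)) / z with hk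
  have hsq : ∀ z ∈ A, k z ^ 2 = -s := by
    intro z hz
    have h1 := hz0 z hz
    have h2 := sq_sub_ne_zero_of_norm_lt (hzr z hz)
    have h3 := sq_sub_ne_zero_of_lt_norm (hzs z hz)
    have h4 : (1 - r * z⁻¹ ^ 2)⁻¹ = z ^ 2 / (z ^ 2 - r) := by
      rw [inv_eq_one_div, div_eq_div_iff _ h2]
      · field_simp
      · intro h0
        apply h2
        field_simp at h0
        rwa [mul_zero] at h0
    have h3' : s - z ^ 2 ≠ 0 := fun h0 => h3 (by linear_combination -h0)
    have h5 : (1 - s⁻¹ * z ^ 2)⁻¹ = -s / (z ^ 2 - s) := by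
      rw [show 1 - s⁻¹ * z ^ 2 = (z ^ 2 - s) / (-s) by field_simp; ring, inv_div]
    simp only [hk]
    rw [div_pow, mul_pow, mul_pow, rsqrtOneSub_sq, rsqrtOneSub_sq,
      hR.sq_eq_of_norm_lt h (hzr z hz) (hzs z hz), h4, h5]
    field_simp
  have hcont : ContinuousOn k A := by
    have hc := differentiableOn_rsqrtOneSub.continuousOn
    refine ContinuousOn.div (ContinuousOn.mul ?_ (ContinuousOn.mul ?_ ?_)) continuousOn_id hz0
    · intro z hz
      exact ((hR.continuousAt hW h (hzr z hz) (hzs z hz)).comp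
        (f := fun z => ((r, s), z)) (by fun_prop)).continuousWithinAt
    · exact hc.comp (continuousOn_const.mul ((continuousOn_id.inv₀ hz0).pow 2)) hb1
    · exact hc.comp (by fun_prop) hb2
  have hmem : (ρ₁ : ℂ) ∈ A := by simp [hA, abs_of_pos hρ₁, hρ]
  have hne : k ρ₁ ≠ 0 := by
    intro h0
    have := hsq _ hmem
    rw [h0, zero_pow two_ne_zero] at this
    exact hsne (neg_eq_zero.1 this.symm)
  have hconst : EqOn k (fun _ => k ρ₁) A :=
    (isPreconnected_annulus hρ₁.le).eq_of_sq_eq hcont continuousOn_const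
      (fun z hz => by simp only [Pi.pow_apply, hsq z hz, hsq _ hmem]) (fun _ => hne) hmem rfl
  refine ⟨k ρ₁, hne, fun z h1 h2 => ?_⟩
  have h3 : k z = k ρ₁ := hconst ⟨h1, h2⟩
  rw [← h3]
  exact (div_mul_cancel₀ _ (hz0 z ⟨h1, h2⟩)).symm

/-- The integral of `F(z) (1 - r/z²)^{-1/2} (1 - t z²)^{-1/2} dz/z` over the circle `|z| = ρ`. -/
noncomputable def doubleKernelIntegral (F : ℂ → ℂ) (ρ : ℝ) (r t : ℂ) : ℂ :=
  ∮ z in C(0, ρ), F z * (rsqrtOneSub (r * z⁻¹ ^ 2) * rsqrtOneSub (t * z ^ 2)) / z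

theorem circleAverage_eq_doubleKernelIntegral (F : ℂ → ℂ) {ρ : ℝ} (hρ : ρ ≠ 0) (r t : ℂ) :
    circleAverage (fun z => F z * (rsqrtOneSub (r * z⁻¹ ^ 2) * rsqrtOneSub (t * z ^ 2))) 0 ρ =
      (2 * π * Complex.I)⁻¹ • doubleKernelIntegral F ρ r t := by
  rw [circleAverage_eq_circleIntegral hρ]
  simp only [doubleKernelIntegral, sub_zero, smul_eq_mul]
  congr 2
  ext z
  ring

theorem continuousOn_rsqrtOneSub_mul {h : ℂ → ℂ} {S : Set ℂ} {u : ℂ} {A : ℝ}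
    (hh : ContinuousOn h S) (hu : ‖u‖ < A) (hA : ∀ z ∈ S, A * ‖h z‖ ≤ 1) :
    ContinuousOn (fun z => rsqrtOneSub (u * h z)) S := by
  refine differentiableOn_rsqrtOneSub.continuousOn.comp (f := fun z => u * h z)
    (continuousOn_const.mul hh) fun z hz => ?_
  rw [mem_ball_zero_iff, norm_mul]
  rcases (norm_nonneg (h z)).eq_or_lt with h0 | h0
  · rw [← h0]; simp
  · exact (mul_lt_mul_of_pos_right hu h0).trans_le (hA z hz)

section Kernel

variable {F : ℂ → ℂ} {ρ₁ ρ₂ ρ : ℝ}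

theorem sq_mul_norm_inv_sq_le_one (hρ₁ : 0 < ρ₁) (h₁ : ρ₁ ≤ ρ) :
    ∀ z ∈ Metric.sphere (0 : ℂ) ρ, ρ₁ ^ 2 * ‖z⁻¹ ^ 2‖ ≤ 1 := by
  intro z hz
  have hn : ‖z‖ = ρ := by simpa using hz
  have h0 : 0 < ρ := hρ₁.trans_le h₁
  rw [norm_pow, norm_inv, hn, inv_pow, ← div_eq_mul_inv, div_le_one (by positivity)]
  gcongr

theorem inv_sq_mul_norm_sq_le_one (hρ : 0 < ρ) (h₂ : ρ ≤ ρ₂) :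
    ∀ z ∈ Metric.sphere (0 : ℂ) ρ, (ρ₂ ^ 2)⁻¹ * ‖z ^ 2‖ ≤ 1 := by
  intro z hz
  have hn : ‖z‖ = ρ := by simpa using hz
  have h0 : 0 < ρ₂ := hρ.trans_le h₂
  rw [norm_pow, hn, inv_mul_le_one₀ (by positivity)]
  gcongr

theorem continuousOn_inv_sq_sphere (hρ : 0 < ρ) :
    ContinuousOn (fun z : ℂ => z⁻¹ ^ 2) (Metric.sphere 0 ρ) :=
  (continuousOn_id.inv₀ fun _ hz => Metric.ne_of_mem_sphere hz hρ.ne').pow 2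

theorem differentiableOn_doubleKernelIntegral_fst (hρ₁ : 0 < ρ₁) (h₁ : ρ₁ ≤ ρ) (h₂ : ρ ≤ ρ₂)
    (hF : ContinuousOn F (Metric.sphere 0 ρ)) {t : ℂ} (ht : ‖t‖ < (ρ₂ ^ 2)⁻¹) :
    DifferentiableOn ℂ (fun r => doubleKernelIntegral F ρ r t) (Metric.ball 0 (ρ₁ ^ 2)) := by
  have h0 := hρ₁.trans_le h₁
  have hg : ContinuousOn (fun z => F z * rsqrtOneSub (t * z ^ 2) / z) (Metric.sphere 0 ρ) :=
    (hF.mul (continuousOn_rsqrtOneSub_mul (h := fun z => z ^ 2) (by fun_prop) ht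
      (inv_sq_mul_norm_sq_le_one h0 h₂))).div continuousOn_id
      fun _ hz => Metric.ne_of_mem_sphere hz h0.ne'
  refine (differentiableOn_circleIntegral_rsqrtOneSub h0.le hg (continuousOn_inv_sq_sphere h0)
    (sq_mul_norm_inv_sq_le_one hρ₁ h₁)).congr fun r _ => ?_
  unfold doubleKernelIntegral
  congr 1
  ext z
  ring

theorem differentiableOn_doubleKernelIntegral_snd (hρ₁ : 0 < ρ₁) (h₁ : ρ₁ ≤ ρ) (h₂ : ρ ≤ ρ₂)
    (hF : ContinuousOn F (Metric.sphere 0 ρ)) {r : ℂ} (hr : ‖r‖ < ρ₁ ^ 2) :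
    DifferentiableOn ℂ (doubleKernelIntegral F ρ r) (Metric.ball 0 (ρ₂ ^ 2)⁻¹) := by
  have h0 := hρ₁.trans_le h₁
  have hg : ContinuousOn (fun z => F z * rsqrtOneSub (r * z⁻¹ ^ 2) / z) (Metric.sphere 0 ρ) :=
    (hF.mul (continuousOn_rsqrtOneSub_mul (h := fun z => z⁻¹ ^ 2) (continuousOn_inv_sq_sphere h0)
      hr (sq_mul_norm_inv_sq_le_one hρ₁ h₁))).div continuousOn_id
      fun _ hz => Metric.ne_of_mem_sphere hz h0.ne'
  refine (differentiableOn_circleIntegral_rsqrtOneSub (h := fun z => z ^ 2) h0.le hg (by fun_prop)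
    (inv_sq_mul_norm_sq_le_one h0 h₂)).congr fun t _ => ?_
  unfold doubleKernelIntegral
  congr 1
  ext z
  ring

end Kernel

/-- If the integrals of `F` divided by the root over the two circles agree for all `(r, s) ∈ W`,
then the circle averages of `F(z) (1 - r/z²)^{-1/2} (1 - t z²)^{-1/2}` agree on the whole bidisc
of parameters `(r, t)`, where `t` stands for `1/s`. -/
theorem IsRootBranch.circleAverage_eq_circleAverage {W : Set (ℂ × ℂ)} {R : ℂ → ℂ → ℂ → ℂ}
    (hR : IsRootBranch W R) (hW : IsOpen W) (hWne : W.Nonempty) {ρ₁ ρ₂ : ℝ} (hρ₁ : 0 < ρ₁)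
    (hρ : ρ₁ ≤ ρ₂) (hWsub : ∀ r s : ℂ, (r, s) ∈ W → ‖r‖ < ρ₁ ^ 2 ∧ ρ₂ ^ 2 < ‖s‖)
    {F : ℂ → ℂ} (hF₁ : ContinuousOn F (Metric.sphere 0 ρ₁))
    (hF₂ : ContinuousOn F (Metric.sphere 0 ρ₂))
    (hint : ∀ r s : ℂ, (r, s) ∈ W →
      (∮ z in C(0, ρ₁), F z / R r s z) = ∮ z in C(0, ρ₂), F z / R r s z)
    {r t : ℂ} (hr : ‖r‖ < ρ₁ ^ 2) (ht : ‖t‖ < (ρ₂ ^ 2)⁻¹) :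
    circleAverage (fun z => F z * (rsqrtOneSub (r * z⁻¹ ^ 2) * rsqrtOneSub (t * z ^ 2))) 0 ρ₁ =
      circleAverage (fun z => F z * (rsqrtOneSub (r * z⁻¹ ^ 2) * rsqrtOneSub (t * z ^ 2)))
        0 ρ₂ := by
  have hρ₂ : 0 < ρ₂ := hρ₁.trans_le hρ
  have hvanish : ∀ r s : ℂ, (r, s) ∈ W →
      doubleKernelIntegral F ρ₁ r s⁻¹ - doubleKernelIntegral F ρ₂ r s⁻¹ = 0 := by
    intro r s h
    obtain ⟨h1, h2⟩ := hWsub r s h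
    obtain ⟨κ, hκ, hκz⟩ := hR.exists_mul_rsqrtOneSub_eq hW h hρ₁ hρ h1 h2
    have hconv : ∀ ρ, ρ₁ ≤ ρ → ρ ≤ ρ₂ → doubleKernelIntegral F ρ r s⁻¹ =
        κ * ∮ z in C(0, ρ), F z / R r s z := by
      intro ρ h3 h4
      rw [← circleIntegral.integral_const_mul, doubleKernelIntegral]
      refine circleIntegral.integral_congr (hρ₁.le.trans h3) fun z hz => ?_
      have hn : ‖z‖ = ρ := by simpa using hz
      have h5 := hκz z (hn ▸ h3) (hn ▸ h4)
      have hz0 := Metric.ne_of_mem_sphere hz (hρ₁.trans_le h3).ne'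
      have hR0 : R r s z ≠ 0 := by
        intro h0
        rw [h0, zero_mul] at h5
        exact mul_ne_zero hκ hz0 h5.symm
      generalize rsqrtOneSub (r * z⁻¹ ^ 2) * rsqrtOneSub (s⁻¹ * z ^ 2) = Q at h5 ⊢
      field_simp
      linear_combination F z * h5
    rw [hconv ρ₁ le_rfl hρ, hconv ρ₂ hρ le_rfl, hint r s h, sub_self]
  obtain ⟨⟨r₀, s₀⟩, h₀⟩ := hWne
  obtain ⟨h01, h02⟩ := hWsub r₀ s₀ h₀
  have hs₀ : s₀ ≠ 0 := norm_pos_iff.1 (lt_of_le_of_lt (sq_nonneg _) h02)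
  have hzero : doubleKernelIntegral F ρ₁ r t - doubleKernelIntegral F ρ₂ r t = 0 := by
    refine eq_zero_of_eventually_eq_zero_bidisc
      (L := fun r t => doubleKernelIntegral F ρ₁ r t - doubleKernelIntegral F ρ₂ r t)
      (r₀ := r₀) (t₀ := s₀⁻¹)
      (fun t ht => ?_) (fun r hr => ?_) (by simpa using h01) ?_ ?_ (by simpa using hr)
      (by simpa using ht)
    · rw [mem_ball_zero_iff] at ht
      exact (differentiableOn_doubleKernelIntegral_fst hρ₁ le_rfl hρ hF₁ ht).sub
        (differentiableOn_doubleKernelIntegral_fst hρ₁ hρ le_rfl hF₂ ht)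
    · rw [mem_ball_zero_iff] at hr
      exact (differentiableOn_doubleKernelIntegral_snd hρ₁ le_rfl hρ hF₁ hr).sub
        (differentiableOn_doubleKernelIntegral_snd hρ₁ hρ le_rfl hF₂ hr)
    · rw [mem_ball_zero_iff, norm_inv]
      exact inv_strictAnti₀ (by positivity) h02
    · have hcont : ContinuousAt (fun p : ℂ × ℂ => (p.1, p.2⁻¹)) (r₀, s₀⁻¹) :=
        continuousAt_fst.prodMk (continuousAt_snd.inv₀ (inv_ne_zero hs₀))
      have hWn : W ∈ 𝓝 ((fun p : ℂ × ℂ => (p.1, p.2⁻¹)) (r₀, s₀⁻¹)) := by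
        simpa using hW.mem_nhds h₀
      filter_upwards [hcont hWn] with p hp
      simpa using hvanish p.1 p.2⁻¹ hp
  rw [circleAverage_eq_doubleKernelIntegral F hρ₁.ne',
    circleAverage_eq_doubleKernelIntegral F hρ₂.ne', sub_eq_zero.1 hzero]

/-! ### The differential equation as an identity between circle integrals -/

theorem sphere_subset_discZero {δ ρ : ℝ} (h : ρ < δ) : Metric.sphere (0 : ℂ) ρ ⊆ discZero δ := by
  intro z hz
  have hn : ‖z‖ = ρ := by simpa using hz
  simpa [discZero, hn] using h

theorem sphere_subset_discInfty {δ ρ : ℝ} (h : δ⁻¹ < ρ) :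
    Metric.sphere (0 : ℂ) ρ ⊆ discInfty δ := by
  intro z hz
  have hn : ‖z‖ = ρ := by simpa using hz
  simpa [discInfty, hn] using h

/-- The operator `(a r + b) ∂/∂r + (a s + b) ∂/∂s` replaces `z φ(z)` under the integral sign by
`(a z² + b) φ'(z) / 2`. -/
theorem twistorG_deriv_add_deriv {δ ρ₁ ρ₂ : ℝ} {φ : ℂ → ℂ} {W : Set (ℂ × ℂ)}
    {R : ℂ → ℂ → ℂ → ℂ} (hR : IsRootBranch W R) (hW : IsOpen W) (hφ : IsOddHolomorphic δ φ)
    (hρ₁ : 0 < ρ₁) (hρ : ρ₁ ≤ ρ₂) (hρ₁δ : ρ₁ < δ) (hρ₂δ : δ⁻¹ < ρ₂)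
    (hWsub : ∀ r s : ℂ, (r, s) ∈ W → ‖r‖ < ρ₁ ^ 2 ∧ ρ₂ ^ 2 < ‖s‖) {r s : ℂ} (h : (r, s) ∈ W)
    (a b : ℂ) :
    (a * r + b) * deriv (fun r' => twistorG ρ₁ ρ₂ R φ r' s) r +
      (a * s + b) * deriv (fun s' => twistorG ρ₁ ρ₂ R φ r s') s =
    -(1 / (4 * (π : ℂ) * Complex.I)) * (2⁻¹ *
      ((∮ z in C(0, ρ₁), (a * z ^ 2 + b) * deriv φ z / R r s z) -
        ∮ z in C(0, ρ₂), (a * z ^ 2 + b) * deriv φ z / R r s z)) := by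
  have h12 : ρ₁ ^ 2 ≤ ρ₂ ^ 2 := by gcongr
  have hρ₂ : 0 < ρ₂ := hρ₁.trans_le hρ
  have hW₁ : ∀ r s : ℂ, (r, s) ∈ W → ‖r‖ < ρ₁ ^ 2 ∧ ρ₁ ^ 2 < ‖s‖ := fun r s h =>
    ⟨(hWsub r s h).1, h12.trans_lt (hWsub r s h).2⟩
  have hW₂ : ∀ r s : ℂ, (r, s) ∈ W → ‖r‖ < ρ₂ ^ 2 ∧ ρ₂ ^ 2 < ‖s‖ := fun r s h =>
    ⟨(hWsub r s h).1.trans_le h12, (hWsub r s h).2⟩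
  have hs₁ := sphere_subset_discZero hρ₁δ
  have hs₂ := sphere_subset_discInfty hρ₂δ
  have hf₁ : ContinuousOn (fun z => z * φ z) (Metric.sphere 0 ρ₁) :=
    continuousOn_id.mul (hφ.differentiableOn_zero.continuousOn.mono hs₁)
  have hf₂ : ContinuousOn (fun z => z * φ z) (Metric.sphere 0 ρ₂) :=
    continuousOn_id.mul (hφ.differentiableOn_infty.continuousOn.mono hs₂)
  have hr : HasDerivAt (fun r' => twistorG ρ₁ ρ₂ R φ r' s) _ r :=
    ((hR.hasDerivAt_circleIntegral_fst hW hρ₁.le hW₁ h hf₁).sub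
      (hR.hasDerivAt_circleIntegral_fst hW hρ₂.le hW₂ h hf₂)).const_mul _
  have hs : HasDerivAt (fun s' => twistorG ρ₁ ρ₂ R φ r s') _ s :=
    ((hR.hasDerivAt_circleIntegral_snd hW hρ₁.le hW₁ h hf₁).sub
      (hR.hasDerivAt_circleIntegral_snd hW hρ₂.le hW₂ h hf₂)).const_mul _
  have hp₁ := hR.circleIntegral_by_parts hW hρ₁.le h (hW₁ r s h).1 (hW₁ r s h).2
    (fun z hz => (hφ.differentiableOn_zero.differentiableAt
      ((isOpen_discZero δ).mem_nhds (hs₁ hz))).hasDerivAt)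
    ((hφ.differentiableOn_zero.deriv (isOpen_discZero δ)).continuousOn.mono hs₁) a b
  have hp₂ := hR.circleIntegral_by_parts hW hρ₂.le h (hW₂ r s h).1 (hW₂ r s h).2
    (fun z hz => (hφ.differentiableOn_infty.differentiableAt
      ((isOpen_discInfty δ).mem_nhds (hs₂ hz))).hasDerivAt)
    ((hφ.differentiableOn_infty.deriv (isOpen_discInfty δ)).continuousOn.mono hs₂) a b
  rw [hr.deriv, hs.deriv]
  linear_combination -(1 / (4 * (π : ℂ) * Complex.I)) * (hp₁ - hp₂)

theorem differentiableOn_mul_rsqrtOneSub_mul_sq {f : ℂ → ℂ} {δ : ℝ} (hδ : δ < 1)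
    (hf : DifferentiableOn ℂ f (Metric.ball 0 δ)) {x : ℂ} (hx : ‖x‖ < 1) :
    DifferentiableOn ℂ (fun z => f z * rsqrtOneSub (x * z ^ 2)) (Metric.ball 0 δ) := by
  refine hf.mul (differentiableOn_rsqrtOneSub.comp (by fun_prop) fun z hz => ?_)
  have hz1 : ‖z‖ < 1 := lt_trans (by simpa using hz) hδ
  rw [mem_ball_zero_iff, norm_mul, norm_pow]
  have : ‖z‖ ^ 2 ≤ 1 := pow_le_one₀ (norm_nonneg z) hz1.le
  nlinarith [norm_nonneg x]

/-- Let `F` be even and holomorphic near `0` and near `∞`, where `ψ` is its expression in the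
coordinate `1/z`.  If the averages of `F` against the product of the two kernels agree on both
circles, then `F` is constant: for `t = 0` the outer average is `ψ 0` by the mean value property,
for `r = 0` the inner one is `F 0`, and in each case the other average determines the function. -/
theorem exists_eq_const_of_circleAverage_eq {F ψ : ℂ → ℂ} {δ ρ₁ ρ₂ : ℝ} (hδ : δ < 1)
    (hρ₁ : 0 < ρ₁) (hρ₁δ : ρ₁ < δ) (hρ₂δ : δ⁻¹ < ρ₂)
    (hF : DifferentiableOn ℂ F (Metric.ball 0 δ)) (hψ : DifferentiableOn ℂ ψ (Metric.ball 0 δ))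
    (hFe : ∀ z ∈ Metric.ball (0 : ℂ) δ, F (-z) = F z)
    (hψe : ∀ z ∈ Metric.ball (0 : ℂ) δ, ψ (-z) = ψ z)
    (hFψ : ∀ w ∈ Metric.ball (0 : ℂ) δ, w ≠ 0 → F w⁻¹ = ψ w)
    (h : ∀ r t : ℂ, ‖r‖ < ρ₁ ^ 2 → ‖t‖ < (ρ₂ ^ 2)⁻¹ →
      circleAverage (fun z => F z * (rsqrtOneSub (r * z⁻¹ ^ 2) * rsqrtOneSub (t * z ^ 2))) 0 ρ₁ =
      circleAverage (fun z => F z * (rsqrtOneSub (r * z⁻¹ ^ 2) * rsqrtOneSub (t * z ^ 2))) 0 ρ₂) :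
    ∃ k : ℂ, ∀ z ∈ discZero δ ∪ discInfty δ, F z = k := by
  have hδ₀ : 0 < δ := hρ₁.trans hρ₁δ
  have hρ₂ : 0 < ρ₂ := (inv_pos.2 hδ₀).trans hρ₂δ
  have hρ₂i : ρ₂⁻¹ < δ := inv_lt_of_inv_lt₀ hδ₀ hρ₂δ
  have hsq₁ : ρ₁ ^ 2 < 1 := pow_lt_one₀ hρ₁.le (hρ₁δ.trans hδ) two_ne_zero
  have hsq₂ : (ρ₂ ^ 2)⁻¹ < 1 := by
    rw [← inv_pow]
    exact pow_lt_one₀ (by positivity) (hρ₂i.trans hδ) two_ne_zero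
  have hinv : ∀ r t : ℂ,
      circleAverage (fun z => F z * (rsqrtOneSub (r * z⁻¹ ^ 2) * rsqrtOneSub (t * z ^ 2))) 0 ρ₂ =
      circleAverage (fun w => ψ w * (rsqrtOneSub (r * w ^ 2) * rsqrtOneSub (t * w⁻¹ ^ 2)))
        0 ρ₂⁻¹ := by
    intro r t
    have h1 := circleAverage_comp_inv
      (fun z => F z * (rsqrtOneSub (r * z⁻¹ ^ 2) * rsqrtOneSub (t * z ^ 2))) ρ₂⁻¹
    rw [inv_inv] at h1
    rw [← h1]
    refine circleAverage_congr_sphere fun w hw => ?_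
    have hn : ‖w‖ = ρ₂⁻¹ := by simpa [abs_of_pos hρ₂] using hw
    have hw0 : w ≠ 0 := norm_pos_iff.1 (hn ▸ inv_pos.2 hρ₂)
    simp only [inv_inv]
    rw [hFψ w (by simpa [hn] using hρ₂i) hw0]
  have hF0 : EqOn F (fun _ => ψ 0) (Metric.ball 0 δ) := by
    refine eqOn_const_of_circleAverage_mul_rsqrtOneSub hρ₁ hρ₁δ hF hFe fun r hr => ?_
    have h1 := h r 0 hr (by simpa using pow_pos hρ₂ 2)
    rw [hinv] at h1
    simp only [zero_mul, rsqrtOneSub_zero, mul_one] at h1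
    rw [h1, circleAverage_eq_of_differentiableOn (inv_pos.2 hρ₂) hρ₂i
      (differentiableOn_mul_rsqrtOneSub_mul_sq hδ hψ (hr.trans hsq₁))]
    simp [rsqrtOneSub_zero]
  have hψ0 : EqOn ψ (fun _ => F 0) (Metric.ball 0 δ) := by
    refine eqOn_const_of_circleAverage_mul_rsqrtOneSub (inv_pos.2 hρ₂) hρ₂i hψ hψe fun t ht => ?_
    rw [inv_pow] at ht
    have h1 := h 0 t (by simpa using pow_pos hρ₁ 2) ht
    rw [hinv] at h1
    simp only [zero_mul, rsqrtOneSub_zero, one_mul] at h1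
    rw [← h1, circleAverage_eq_of_differentiableOn hρ₁ hρ₁δ
      (differentiableOn_mul_rsqrtOneSub_mul_sq hδ hF (ht.trans hsq₂))]
    simp [rsqrtOneSub_zero]
  refine ⟨F 0, fun z hz => ?_⟩
  rcases hz with hz | hz
  · rw [discZero_eq_ball] at hz
    rw [hF0 hz, hF0 (Metric.mem_ball_self hδ₀)]
  · have hz' : δ⁻¹ < ‖z‖ := hz
    have hz0 : 0 < ‖z‖ := (inv_pos.2 hδ₀).trans hz'
    have hw : z⁻¹ ∈ Metric.ball (0 : ℂ) δ := by
      rw [mem_ball_zero_iff, norm_inv]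
      exact inv_lt_of_inv_lt₀ hδ₀ hz'
    have h1 := hFψ z⁻¹ hw (inv_ne_zero (norm_pos_iff.1 hz0))
    rw [inv_inv] at h1
    rw [h1, hψ0 hw]

theorem mainTheorem7 (δ : ℝ) (hδ₀ : 0 < δ) (hδ₁ : δ < 1)
    (φ₁ φ₂ : ℂ → ℂ) (hφ₁ : IsOddHolomorphic δ φ₁) (hφ₂ : IsOddHolomorphic δ φ₂)
    (ρ₁ ρ₂ : ℝ) (hρ₁ : 0 < ρ₁) (hρ₁δ : ρ₁ < δ) (hρ₂δ : δ⁻¹ < ρ₂)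
    (W : Set (ℂ × ℂ)) (hW : IsOpen W) (hWne : W.Nonempty)
    (hWsub : ∀ r s : ℂ, (r, s) ∈ W → ‖r‖ < ρ₁ ^ 2 ∧ ρ₂ ^ 2 < ‖s‖)
    (R : ℂ → ℂ → ℂ → ℂ) (hR : IsRootBranch W R)
    (a b c d : ℂ)
    (hG : ∀ r s : ℂ, (r, s) ∈ W →
      (a * r + b) * deriv (fun r' => twistorG ρ₁ ρ₂ R φ₁ r' s) r
        + (c * r + d) * deriv (fun r' => twistorG ρ₁ ρ₂ R φ₂ r' s) r
        + (a * s + b) * deriv (fun s' => twistorG ρ₁ ρ₂ R φ₁ r s') s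
        + (c * s + d) * deriv (fun s' => twistorG ρ₁ ρ₂ R φ₂ r s') s = 0) :
    ∃ k : ℂ, ∀ z ∈ discZero δ ∪ discInfty δ,
      (a * z ^ 2 + b) * deriv φ₁ z + (c * z ^ 2 + d) * deriv φ₂ z = k := by
  have hρ : ρ₁ ≤ ρ₂ := by
    have h1 : 1 < δ⁻¹ := (one_lt_inv₀ hδ₀).2 hδ₁
    linarith
  have hρ₂ : 0 < ρ₂ := hρ₁.trans_le hρ
  set F : ℂ → ℂ := fun z => (a * z ^ 2 + b) * deriv φ₁ z + (c * z ^ 2 + d) * deriv φ₂ z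
  set g₁ : ℂ → ℂ := fun w => φ₁ w⁻¹
  set g₂ : ℂ → ℂ := fun w => φ₂ w⁻¹
  have hd₁ : DifferentiableOn ℂ g₁ (Metric.ball 0 δ) := hφ₁.differentiableOn_comp_inv hδ₀
  have hd₂ : DifferentiableOn ℂ g₂ (Metric.ball 0 δ) := hφ₂.differentiableOn_comp_inv hδ₀
  have hpoly : ∀ (p q : ℂ) (U : Set ℂ), DifferentiableOn ℂ (fun z : ℂ => p * z ^ 2 + q) U :=
    fun p q U => by fun_prop
  have hFz : DifferentiableOn ℂ F (discZero δ) :=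
    ((hpoly a b _).mul (hφ₁.differentiableOn_zero.deriv (isOpen_discZero δ))).add
      ((hpoly c d _).mul (hφ₂.differentiableOn_zero.deriv (isOpen_discZero δ)))
  have hFi : DifferentiableOn ℂ F (discInfty δ) :=
    ((hpoly a b _).mul (hφ₁.differentiableOn_infty.deriv (isOpen_discInfty δ))).add
      ((hpoly c d _).mul (hφ₂.differentiableOn_infty.deriv (isOpen_discInfty δ)))
  -- the differential equation says that the integrals of `F` over the two circles agree
  have hint : ∀ r s : ℂ, (r, s) ∈ W →
      (∮ z in C(0, ρ₁), F z / R r s z) = ∮ z in C(0, ρ₂), F z / R r s z := by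
    intro r s h
    have h12 : ρ₁ ^ 2 ≤ ρ₂ ^ 2 := by gcongr
    have hci : ∀ (ρ : ℝ) (U : Set ℂ) (φ : ℂ → ℂ) (p q : ℂ), 0 ≤ ρ → ‖r‖ < ρ ^ 2 → ρ ^ 2 < ‖s‖ →
        IsOpen U → Metric.sphere 0 ρ ⊆ U → DifferentiableOn ℂ φ U →
        CircleIntegrable (fun z => (p * z ^ 2 + q) * deriv φ z / R r s z) 0 ρ := by
      intro ρ U φ p q hρ h1 h2 hU hs hφ
      have hn : ∀ z ∈ Metric.sphere (0 : ℂ) ρ, ‖r‖ < ‖z‖ ^ 2 ∧ ‖z‖ ^ 2 < ‖s‖ := by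
        intro z hz
        have : ‖z‖ = ρ := by simpa using hz
        rw [this]
        exact ⟨h1, h2⟩
      refine ContinuousOn.circleIntegrable hρ (ContinuousOn.div
        ((hpoly p q _).continuousOn.mul ((hφ.deriv hU).continuousOn.mono hs)) (fun z hz => ?_)
        fun z hz => hR.ne_zero h (hn z hz).1 (hn z hz).2)
      exact ((hR.continuousAt hW h (hn z hz).1 (hn z hz).2).comp
        (f := fun z => ((r, s), z)) (by fun_prop)).continuousWithinAt
    have hsplit : ∀ (ρ : ℝ) (U : Set ℂ), 0 ≤ ρ → ‖r‖ < ρ ^ 2 → ρ ^ 2 < ‖s‖ →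
        IsOpen U → Metric.sphere 0 ρ ⊆ U → DifferentiableOn ℂ φ₁ U → DifferentiableOn ℂ φ₂ U →
        (∮ z in C(0, ρ), F z / R r s z) =
          (∮ z in C(0, ρ), (a * z ^ 2 + b) * deriv φ₁ z / R r s z) +
          ∮ z in C(0, ρ), (c * z ^ 2 + d) * deriv φ₂ z / R r s z := by
      intro ρ U h0 h1 h2 hU hs h3 h4
      rw [← circleIntegral.integral_add (hci ρ U φ₁ a b h0 h1 h2 hU hs h3)
        (hci ρ U φ₂ c d h0 h1 h2 hU hs h4)]
      simp only [F, add_div]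
    obtain ⟨h1, h2⟩ := hWsub r s h
    rw [hsplit ρ₁ _ hρ₁.le h1 (h12.trans_lt h2) (isOpen_discZero δ) (sphere_subset_discZero hρ₁δ)
        hφ₁.differentiableOn_zero hφ₂.differentiableOn_zero,
      hsplit ρ₂ _ hρ₂.le (h1.trans_le h12) h2 (isOpen_discInfty δ) (sphere_subset_discInfty hρ₂δ)
        hφ₁.differentiableOn_infty hφ₂.differentiableOn_infty]
    have e₁ := twistorG_deriv_add_deriv hR hW hφ₁ hρ₁ hρ hρ₁δ hρ₂δ hWsub h a b
    have e₂ := twistorG_deriv_add_deriv hR hW hφ₂ hρ₁ hρ hρ₁δ hρ₂δ hWsub h c d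
    have hC : -(1 / (4 * (π : ℂ) * Complex.I)) * 2⁻¹ ≠ 0 := by
      simp [Real.pi_ne_zero, Complex.I_ne_zero]
    refine sub_eq_zero.1 ((mul_eq_zero.1
      (?_ : -(1 / (4 * (π : ℂ) * Complex.I)) * 2⁻¹ * _ = 0)).resolve_left hC)
    linear_combination hG r s h - e₁ - e₂
  have hchain : ∀ φ : ℂ → ℂ, IsOddHolomorphic δ φ → ∀ w ∈ Metric.ball (0 : ℂ) δ, w ≠ 0 →
      deriv (fun w => φ w⁻¹) w = deriv φ w⁻¹ * -(w ^ 2)⁻¹ := by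
    intro φ hφ w hw hw0
    have hwi : w⁻¹ ∈ discInfty δ := by
      rw [discInfty, mem_ofPred_eq, norm_inv]
      exact inv_strictAnti₀ (norm_pos_iff.2 hw0) (by simpa using hw)
    exact ((hφ.differentiableOn_infty.differentiableAt
      ((isOpen_discInfty δ).mem_nhds hwi)).hasDerivAt.comp w (hasDerivAt_inv hw0)).deriv
  have hodd : ∀ φ : ℂ → ℂ, IsOddHolomorphic δ φ → ∀ w ∈ Metric.ball (0 : ℂ) δ,
      φ (-w)⁻¹ = -φ w⁻¹ := by
    intro φ hφ w hw
    rw [inv_neg]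
    by_cases hw0 : w = 0
    · simp [hw0, hφ.map_zero hδ₀]
    · refine hφ.odd _ (Or.inr ?_)
      rw [discInfty, mem_ofPred_eq, norm_inv]
      exact inv_strictAnti₀ (norm_pos_iff.2 hw0) (by simpa using hw)
  -- `F` in the coordinate `w = 1/z`, where `φ'(z) = -w² g'(w)`
  refine exists_eq_const_of_circleAverage_eq hδ₁ hρ₁ hρ₁δ hρ₂δ
    (ψ := fun w => -((b * w ^ 2 + a) * deriv g₁ w + (d * w ^ 2 + c) * deriv g₂ w))
    (discZero_eq_ball δ ▸ hFz) ?_ ?_ ?_ ?_ ?_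
  · exact (((hpoly b a _).mul (hd₁.deriv Metric.isOpen_ball)).add
      ((hpoly d c _).mul (hd₂.deriv Metric.isOpen_ball))).neg
  · intro z hz
    rw [← discZero_eq_ball] at hz
    simp only [neg_sq,
      deriv_neg_of_odd_on (isOpen_discZero δ) (fun z hz => hφ₁.odd z (Or.inl hz)) hz,
      deriv_neg_of_odd_on (isOpen_discZero δ) (fun z hz => hφ₂.odd z (Or.inl hz)) hz]
  · intro w hw
    simp only [neg_sq, deriv_neg_of_odd_on (φ := g₁) Metric.isOpen_ball (hodd φ₁ hφ₁) hw,
      deriv_neg_of_odd_on (φ := g₂) Metric.isOpen_ball (hodd φ₂ hφ₂) hw]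
  · intro w hw hw0
    simp only [g₁, g₂, hchain φ₁ hφ₁ w hw hw0, hchain φ₂ hφ₂ w hw hw0]
    field_simp
    ring
  · intro r t hr ht
    exact hR.circleAverage_eq_circleAverage hW hWne hρ₁ hρ hWsub
      (hFz.continuousOn.mono (sphere_subset_discZero hρ₁δ))
      (hFi.continuousOn.mono (sphere_subset_discInfty hρ₂δ)) hint hr ht
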